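/- Let $H\in(0,1)$ and $\kappa\in(0,\infty)$. On a probability space $(\Omega,\mathcal F,P)$ let $\mathbb B^H=\{\mathbb B^H_t\}_{t\ge 0}$ be a fractional Brownian motion with Hurst index $H$, that is, a centred Gaussian process with covariance $\operatorname{Cov}(\mathbb B^H_s,\mathbb B^H_t)=\tfrac12\left(s^{2H}+t^{2H}-|s-t|^{2H}\right)$, $s,t\ge 0$, and almost surely continuous sample paths. Let $\{(\eta_i,U_i)\}_{i\in\mathbb N}$ be a Poisson point process on $[0,\infty)\times[0,\infty)$ with intensity $H^{-1}x^{-1-1/H}\,dx\,du$, independent of $\mathbb B^H$. Put $$Z^H_t=\sup_{s\in[0,t]}\Bigl(\mathbb B^H_s+\kappa^H\sum_{i}\eta_i\,\mathbf 1_{\{U_i=s\}}\Bigr),\qquad t\ge 0,$$ and let $\Psi_H(x)=P(Z^H_1\le x)$, $x\in\mathbb R$. Then $\Psi_H(x)=0$ for all $x\le 0$; $\Psi_H$ is continuous and strictly increasing on $(0,\infty)$; and $\lim_{x\to\infty}\Psi_H(x)=1$. -/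

import Mathlib

open MeasureTheory ProbabilityTheory Filter Set
open scoped NNReal ENNReal Topology

noncomputable section

/-- `B` is a (standard) fractional Brownian motion with Hurst index `H` on the probability space
`(Ω, P)`: a centred Gaussian process with the usual covariance function and almost surely
continuous sample paths. -/
structure IsFractionalBrownianMotion {Ω : Type*} [MeasurableSpace Ω] (H : ℝ)
    (B : ℝ≥0 → Ω → ℝ) (P : Measure Ω) : Prop where
  measurable : ∀ t, Measurable (B t)
  isGaussianProcess : IsGaussianProcess B P
  mean_zero : ∀ t, ∫ ω, B t ω ∂P = 0
  covariance_eq : ∀ s t : ℝ≥0, cov[B s, B t; P] =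
    ((s : ℝ) ^ (2 * H) + (t : ℝ) ^ (2 * H) - |(s : ℝ) - (t : ℝ)| ^ (2 * H)) / 2
  continuous_paths : ∀ᵐ ω ∂P, Continuous fun t => B t ω

/-- The number of points (counted with multiplicity) of the random sequence `X` in the set `A`. -/
def pointCount {Ω E : Type*} (X : ℕ → Ω → E) (A : Set E) (ω : Ω) : ℕ∞ :=
  {i : ℕ | X i ω ∈ A}.encard

/-- The Poisson distribution on `{0, 1, 2, …, ∞}` with parameter `c ∈ [0, ∞]`; for `c = ∞` it is
the unit mass at `∞`. -/
def extendedPoisson (c : ℝ≥0∞) : Measure ℕ∞ :=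
  open Classical in
  if c = ∞ then Measure.dirac ⊤ else (poissonMeasure c.toNNReal).map (Nat.cast : ℕ → ℕ∞)

/-- The random points `X 0, X 1, …` form a Poisson point process on `E` with intensity measure
`μ`. -/
structure IsPoissonPointProcess {Ω E : Type*} [MeasurableSpace Ω] [MeasurableSpace E]
    (X : ℕ → Ω → E) (μ : Measure E) (P : Measure Ω) : Prop where
  measurable : ∀ i, Measurable (X i)
  hasLaw_count : ∀ A : Set E, MeasurableSet A →
    HasLaw (pointCount X A) (extendedPoisson (μ A)) P
  indep_count : ∀ (n : ℕ) (A : Fin n → Set E), (∀ k, MeasurableSet (A k)) →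
    Pairwise (fun j k => Disjoint (A j) (A k)) → iIndepFun (fun k => pointCount X (A k)) P

/-- Lebesgue measure on the half-line `[0, ∞)`. -/
def lebesgueNNReal : Measure ℝ≥0 :=
  ((volume : Measure ℝ).restrict (Set.Ici 0)).map Real.toNNReal

/-- The intensity measure `H⁻¹ x ^ (-1 - 1/H) dx du` on `[0, ∞) × [0, ∞)`. -/
def shotNoiseIntensity (H : ℝ) : Measure (ℝ≥0 × ℝ≥0) :=
  (lebesgueNNReal.prod lebesgueNNReal).withDensity
    fun p => ENNReal.ofReal (H⁻¹ * (p.1 : ℝ) ^ (-1 - 1 / H))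

/-- The process `B` and the point process with points `X 0, X 1, …` are independent: the path of
`B` is independent of the family of all the counts of points in measurable sets. This does not
depend on the enumeration of the points. -/
def IndepOfPointProcess {Ω E : Type*} [MeasurableSpace Ω] [MeasurableSpace E]
    (B : ℝ≥0 → Ω → ℝ) (X : ℕ → Ω → E) (P : Measure Ω) : Prop :=
  IndepFun (fun ω (t : ℝ≥0) => B t ω)
    (fun ω (A : {A : Set E // MeasurableSet A}) => pointCount X A.1 ω) P

/-- The shot noise `∑ i, η i * 1_{U i = s}` at time `s`, where `X i = (η i, U i)`. -/
def shotNoise {Ω : Type*} (X : ℕ → Ω → ℝ≥0 × ℝ≥0) (s : ℝ≥0) (ω : Ω) : ℝ≥0∞ :=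
  open Classical in
  ∑' i, if (X i ω).2 = s then ((X i ω).1 : ℝ≥0∞) else 0

/-- The maximum process of fractional Brownian motion with shot noise,
`Z t = sup_{s ∈ [0, t]} (B s + κ ^ H * ∑ i, η i * 1_{U i = s})`, as an extended real number. -/
def maxProcess {Ω : Type*} (H κ : ℝ) (B : ℝ≥0 → Ω → ℝ) (X : ℕ → Ω → ℝ≥0 × ℝ≥0)
    (t : ℝ≥0) (ω : Ω) : EReal :=
  ⨆ s ∈ Set.Icc 0 t,
    ((B s ω : EReal) + ((ENNReal.ofReal (κ ^ H) * shotNoise X s ω : ℝ≥0∞) : EReal))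

/-- The marginal distribution function `Ψ x = P (Z 1 ≤ x)`. -/
def marginalCDF {Ω : Type*} [MeasurableSpace Ω] (H κ : ℝ) (B : ℝ≥0 → Ω → ℝ)
    (X : ℕ → Ω → ℝ≥0 × ℝ≥0) (P : Measure Ω) (x : ℝ) : ℝ :=
  P.real {ω | maxProcess H κ B X 1 ω ≤ (x : EReal)}

end

/-! ### Lebesgue measure on the half-line -/

section Lebesgue

/-! Fix the path of `B`. Almost surely no two noise points of positive height share a time in `[0,
1]`, and the times of the points are dense there. Hence `Z_1 ≤ y` says exactly that no point `(x,
u)` with `u ≤ 1` lies in the region `κ ^ H * x > y - B u` (`maxProcess_le_iff`). By independence and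
the Poisson void probability, `Ψ(y) = E exp(-Λ_y)` with `Λ_y = ∫_0^1 κ (y - B u)_+ ^ (-1/H) du`,
where `0 ^ (-1/H) = ∞` (`marginalCDF_eq`). All claims are read off from this formula; `Λ_y` is
`exceedanceMass`.

For `y ≤ 0`, `Λ_y = ∞` almost surely: `B u` is of order `u ^ H`, so the integrand at level `0` is of
order `1/u`, which is not integrable at `0` (`ae_exceedanceMass_zero_eq_top`).

For continuity at `y > 0`, `Λ` is finite and continuous at `y` if `max B < y`, and is `∞` near `y`
if `max B > y`. The case `max B = y` is null (`ae_not_max_eq`): write `B t = R t + c t * B 1` with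
`R` independent of the Gaussian `B 1` and `c > 0` on `(0, 1]`; for given `R`, at most one value of
`B 1` gives the maximum `y`. Dominated convergence then gives continuity of `Ψ`, and also its limit
at infinity.

Strict monotonicity holds because `Λ` strictly decreases from `x` to `y > x` on the event `max B ≤
x`, which has positive probability by the same decomposition (`measure_forall_le_pos`). -/

instance : SFinite lebesgueNNReal := by
  unfold lebesgueNNReal; infer_instance

theorem lebesgueNNReal_apply {s : Set ℝ≥0} (hs : MeasurableSet s) :
    lebesgueNNReal s = volume (Real.toNNReal ⁻¹' s ∩ Ici 0) := by
  rw [lebesgueNNReal, Measure.map_apply measurable_real_toNNReal hs,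
    Measure.restrict_apply (measurable_real_toNNReal hs)]

theorem setLIntegral_lebesgueNNReal {s : Set ℝ≥0} (hs : MeasurableSet s) {f : ℝ≥0 → ℝ≥0∞}
    (hf : Measurable f) :
    ∫⁻ u in s, f u ∂lebesgueNNReal =
      ∫⁻ t in Real.toNNReal ⁻¹' s ∩ Ici 0, f t.toNNReal := by
  rw [lebesgueNNReal, Measure.restrict_map measurable_real_toNNReal hs,
    lintegral_map hf measurable_real_toNNReal,
    Measure.restrict_restrict (measurable_real_toNNReal hs)]

theorem lebesgueNNReal_Ico_le (a b : ℝ≥0) :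
    lebesgueNNReal (Ico a b) ≤ ENNReal.ofReal (b - a) := by
  rw [lebesgueNNReal_apply measurableSet_Ico, ← Real.volume_Ico]
  refine measure_mono fun t ht => ?_
  obtain ⟨⟨h1, h2⟩, h3⟩ := ht
  rw [Real.le_toNNReal_iff_coe_le h3] at h1
  rw [Real.toNNReal_lt_iff_lt_coe h3] at h2
  exact ⟨h1, h2⟩

theorem lebesgueNNReal_Iic_one_lt_top : lebesgueNNReal (Iic 1) < ∞ :=
  calc lebesgueNNReal (Iic 1) ≤ lebesgueNNReal (Ico 0 2) :=
        measure_mono fun _ hu => ⟨zero_le, lt_of_le_of_lt hu one_lt_two⟩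
    _ ≤ _ := lebesgueNNReal_Ico_le 0 2
    _ < ∞ := ENNReal.ofReal_lt_top

theorem lebesgueNNReal_Ioo_pos {a b : ℝ≥0} (hab : a < b) : 0 < lebesgueNNReal (Ioo a b) := by
  rw [lebesgueNNReal_apply measurableSet_Ioo]
  have h : 0 < volume (Ioo (a : ℝ) b) := by simpa using hab
  refine h.trans_le (measure_mono fun t ht => ?_)
  have h0 : 0 ≤ t := a.2.trans ht.1.le
  refine ⟨⟨?_, ?_⟩, h0⟩
  · rw [Real.lt_toNNReal_iff_coe_lt]; exact ht.1
  · rw [Real.toNNReal_lt_iff_lt_coe h0]; exact ht.2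

theorem lebesgueNNReal_inter_Iic_one_pos {U : Set ℝ≥0} (hU : IsOpen U) {u : ℝ≥0} (hu : u ∈ U)
    (hu1 : u ≤ 1) : 0 < lebesgueNNReal (U ∩ Iic 1) := by
  obtain ⟨v, hv, hv1⟩ : ∃ v ∈ U, v < 1 := by
    rcases hu1.lt_or_eq with h | rfl
    · exact ⟨u, hu, h⟩
    · have : ∀ᶠ v in 𝓝[<] (1 : ℝ≥0), v ∈ U := mem_nhdsWithin_of_mem_nhds (hU.mem_nhds hu)
      have hne : (𝓝[<] (1 : ℝ≥0)).NeBot := nhdsLT_neBot_of_exists_lt ⟨0, one_pos⟩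
      obtain ⟨v, h1, h2⟩ := (this.and self_mem_nhdsWithin).exists
      exact ⟨v, h1, h2⟩
  obtain ⟨w, hw, hsub⟩ := exists_Ico_subset_of_mem_nhds
    ((hU.inter isOpen_Iio).mem_nhds ⟨hv, hv1⟩) ⟨1, hv1⟩
  refine (lebesgueNNReal_Ioo_pos hw).trans_le (measure_mono fun t ht => ?_)
  obtain ⟨h1, h2⟩ := hsub ⟨ht.1.le, ht.2⟩
  exact ⟨h1, (mem_Iio.1 h2).le⟩

/-- This divergence is the source of `Ψ = 0` on `(-∞, 0]`. -/
theorem setLIntegral_inv_lebesgueNNReal :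
    ∫⁻ u in Iic 1, (u : ℝ≥0∞)⁻¹ ∂lebesgueNNReal = ∞ := by
  rw [setLIntegral_lebesgueNNReal measurableSet_Iic (by fun_prop)]
  by_contra hne
  have hset : Ioc (0 : ℝ) 1 ⊆ Real.toNNReal ⁻¹' Iic 1 ∩ Ici 0 := fun t ht =>
    ⟨by simpa using ht.2, ht.1.le⟩
  have hfin : ∫⁻ t in Ioc (0 : ℝ) 1, ‖t⁻¹‖ₑ < ∞ := by
    refine lt_of_le_of_lt ?_ (lt_of_le_of_lt (lintegral_mono_set hset) (lt_top_iff_ne_top.2 hne))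
    refine setLIntegral_mono' measurableSet_Ioc fun t ht => ?_
    rw [Real.enorm_of_nonneg (inv_nonneg.2 ht.1.le), ENNReal.ofReal_inv_of_pos ht.1]
    rfl
  have hint : IntervalIntegrable (fun t : ℝ => t⁻¹) volume 0 1 := by
    rw [intervalIntegrable_iff_integrableOn_Ioc_of_le zero_le_one]
    exact ⟨by fun_prop, hfin⟩
  rw [intervalIntegrable_inv_iff] at hint
  simp at hint

end Lebesgue

/-! ### Intensity of the noise above a level or a graph -/

section NoiseTail

/-- The rate `κ * z ^ (-1 / H)` at which points with scaled height `κ ^ H * x` above `z` occur. -/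
noncomputable def noiseTail (H κ z : ℝ) : ℝ≥0∞ :=
  ENNReal.ofReal κ * ENNReal.ofReal z ^ (-(1 / H))

variable {H κ : ℝ}

theorem noiseTail_of_nonpos (hH : 0 < H) (hκ : 0 < κ) {z : ℝ} (hz : z ≤ 0) :
    noiseTail H κ z = ∞ := by
  have : -(1 / H) < 0 := neg_lt_zero.2 (by positivity)
  rw [noiseTail, ENNReal.ofReal_of_nonpos hz, ENNReal.zero_rpow_of_neg this, ENNReal.mul_top]
  simpa using hκ

theorem noiseTail_of_pos (hκ : 0 < κ) {z : ℝ} (hz : 0 < z) :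
    noiseTail H κ z = ENNReal.ofReal (κ * z ^ (-(1 / H))) := by
  rw [noiseTail, ENNReal.ofReal_rpow_of_pos hz, ENNReal.ofReal_mul hκ.le]

theorem noiseTail_lt_top (hκ : 0 < κ) {z : ℝ} (hz : 0 < z) : noiseTail H κ z < ∞ := by
  rw [noiseTail_of_pos hκ hz]; exact ENNReal.ofReal_lt_top

theorem continuous_noiseTail : Continuous (noiseTail H κ) := by
  unfold noiseTail
  exact (ENNReal.continuous_const_mul ENNReal.ofReal_ne_top).comp
    (ENNReal.continuous_rpow_const.comp ENNReal.continuous_ofReal)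

theorem antitone_noiseTail (hH : 0 < H) : Antitone (noiseTail H κ) := by
  intro z w hzw
  unfold noiseTail
  rw [ENNReal.rpow_neg, ENNReal.rpow_neg]
  gcongr

theorem noiseTail_lt_noiseTail (hH : 0 < H) (hκ : 0 < κ) {z w : ℝ} (hzw : z < w) (hw : 0 < w) :
    noiseTail H κ w < noiseTail H κ z := by
  rcases le_or_gt z 0 with hz | hz
  · rw [noiseTail_of_nonpos hH hκ hz]; exact noiseTail_lt_top hκ hw
  · rw [noiseTail_of_pos hκ hz, noiseTail_of_pos hκ hw, ENNReal.ofReal_lt_ofReal_iff (by positivity)]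
    gcongr 1
    exact Real.rpow_lt_rpow_of_neg hz hzw (neg_lt_zero.2 (by positivity))

theorem tendsto_noiseTail_atTop (hH : 0 < H) : Tendsto (noiseTail H κ) atTop (𝓝 0) := by
  have h1 : Tendsto (fun z : ℝ => ENNReal.ofReal z ^ (1 / H)) atTop (𝓝 ∞) := by
    have := (ENNReal.continuous_rpow_const (y := 1 / H)).tendsto ∞
    rw [ENNReal.top_rpow_of_pos (by positivity)] at this
    exact this.comp ENNReal.tendsto_ofReal_atTop
  have h2 := (ENNReal.continuous_const_mul (a := ENNReal.ofReal κ) ENNReal.ofReal_ne_top).tendsto 0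
  rw [mul_zero] at h2
  refine h2.comp ?_
  simp_rw [ENNReal.rpow_neg]
  simpa using (tendsto_inv_iff.2 h1)

theorem setLIntegral_Ioi_shotNoise_density (hH : 0 < H) {a : ℝ} (ha : 0 < a) :
    ∫⁻ t in Ioi a, ENNReal.ofReal (H⁻¹ * t ^ (-1 - 1 / H)) = ENNReal.ofReal (a ^ (-(1 / H))) := by
  have hlt : -1 - 1 / H < -1 := by
    have : 0 < 1 / H := by positivity
    linarith
  rw [← ofReal_integral_eq_lintegral_ofReal, integral_const_mul, integral_Ioi_rpow_of_lt hlt ha]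
  · congr 1
    have : -1 - 1 / H + 1 = -(1 / H) := by ring
    rw [this]
    field_simp
  · exact (integrableOn_Ioi_rpow_of_lt hlt ha).const_mul _
  · filter_upwards [ae_restrict_mem measurableSet_Ioi] with t ht
    have : 0 < t := ha.trans ht
    positivity

theorem measurable_shotNoise_density (H : ℝ) :
    Measurable fun x : ℝ≥0 => ENNReal.ofReal (H⁻¹ * (x : ℝ) ^ (-1 - 1 / H)) := by
  fun_prop

/-- For `z > 0` the factor `κ ^ H` comes out of the power `-1/H` as `κ`. For `z ≤ 0` both sides are
infinite, because small points have infinite total mass. -/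
theorem setLIntegral_shotNoise_density (hH : 0 < H) (hκ : 0 < κ) (z : ℝ) :
    ∫⁻ x in {x : ℝ≥0 | z < κ ^ H * x}, ENNReal.ofReal (H⁻¹ * (x : ℝ) ^ (-1 - 1 / H))
      ∂lebesgueNNReal = noiseTail H κ z := by
  have hκH : 0 < κ ^ H := Real.rpow_pos_of_pos hκ H
  have key : ∀ w : ℝ, 0 < w →
      ∫⁻ x in {x : ℝ≥0 | w < κ ^ H * x}, ENNReal.ofReal (H⁻¹ * (x : ℝ) ^ (-1 - 1 / H))
        ∂lebesgueNNReal = noiseTail H κ w := by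
    intro w hw
    have hms : MeasurableSet {x : ℝ≥0 | w < κ ^ H * x} :=
      measurableSet_lt measurable_const (by fun_prop)
    rw [setLIntegral_lebesgueNNReal hms (measurable_shotNoise_density H)]
    have hset : Real.toNNReal ⁻¹' {x : ℝ≥0 | w < κ ^ H * x} ∩ Ici 0 = Ioi (w / κ ^ H) := by
      ext t
      simp only [mem_inter_iff, mem_preimage, mem_ofPred_eq, mem_Ici, mem_Ioi, div_lt_iff₀' hκH]
      constructor
      · rintro ⟨h1, h2⟩
        rwa [Real.coe_toNNReal _ h2] at h1
      · intro h
        have : 0 ≤ t := by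
          by_contra hneg
          nlinarith
        exact ⟨by rwa [Real.coe_toNNReal _ this], this⟩
    have hpos : 0 < w / κ ^ H := by positivity
    rw [hset, noiseTail_of_pos hκ hw]
    trans ∫⁻ t in Ioi (w / κ ^ H), ENNReal.ofReal (H⁻¹ * t ^ (-1 - 1 / H))
    · refine setLIntegral_congr_fun measurableSet_Ioi fun t ht => ?_
      have h0 : 0 ≤ t := (hpos.trans ht).le
      simp only [Real.coe_toNNReal t h0]
    · rw [setLIntegral_Ioi_shotNoise_density hH hpos]
      congr 1
      rw [Real.div_rpow hw.le hκH.le, ← Real.rpow_mul hκ.le]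
      have : H * -(1 / H) = -1 := by field_simp
      rw [this, Real.rpow_neg_one]
      field_simp
  rcases le_or_gt z 0 with hz | hz
  · rw [noiseTail_of_nonpos hH hκ hz, eq_top_iff]
    -- The region for `z ≤ 0` contains those for all levels `w > 0`, whose masses blow up as `w ↓
    -- 0`.
    have hlim : Tendsto (noiseTail H κ) (𝓝[>] 0) (𝓝 ∞) := by
      have := (continuous_noiseTail (H := H) (κ := κ)).tendsto 0
      rw [noiseTail_of_nonpos hH hκ le_rfl] at this
      exact this.mono_left nhdsWithin_le_nhds
    refine le_of_tendsto hlim ?_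
    filter_upwards [self_mem_nhdsWithin] with w hw
    rw [← key w hw]
    exact lintegral_mono_set fun x hx => (hz.trans_lt hw).trans hx
  · exact key z hz

theorem shotNoiseIntensity_apply {A : Set (ℝ≥0 × ℝ≥0)} (hA : MeasurableSet A) :
    shotNoiseIntensity H A = ∫⁻ u, ∫⁻ x in {x | (x, u) ∈ A},
      ENNReal.ofReal (H⁻¹ * (x : ℝ) ^ (-1 - 1 / H)) ∂lebesgueNNReal ∂lebesgueNNReal := by
  have hd : Measurable fun p : ℝ≥0 × ℝ≥0 => ENNReal.ofReal (H⁻¹ * (p.1 : ℝ) ^ (-1 - 1 / H)) := by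
    fun_prop
  rw [shotNoiseIntensity, withDensity_apply _ hA, ← lintegral_indicator hA,
    lintegral_prod_symm _ (hd.indicator hA).aemeasurable]
  refine lintegral_congr fun u => ?_
  have hs : MeasurableSet {x | (x, u) ∈ A} := measurable_prodMk_right hA
  rw [← lintegral_indicator hs]
  rfl

theorem shotNoiseIntensity_above (hH : 0 < H) (hκ : 0 < κ) {f : ℝ≥0 → ℝ} (hf : Measurable f)
    {J : Set ℝ≥0} (hJ : MeasurableSet J) :
    shotNoiseIntensity H {p | p.2 ∈ J ∧ f p.2 < κ ^ H * p.1} =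
      ∫⁻ u in J, noiseTail H κ (f u) ∂lebesgueNNReal := by
  rw [shotNoiseIntensity_apply, ← lintegral_indicator hJ]
  · refine lintegral_congr fun u => ?_
    by_cases hu : u ∈ J
    · simp only [mem_ofPred_eq, hu, true_and, indicator_of_mem]
      exact setLIntegral_shotNoise_density hH hκ (f u)
    · simp [hu]
  · exact (measurable_snd hJ).inter (measurableSet_lt (hf.comp measurable_snd)
      (measurable_const.mul measurable_fst.coe_nnreal_real))

end NoiseTail

/-! ### Void probabilities and multiple points -/

section Poisson

theorem extendedPoisson_zero (c : ℝ≥0∞) :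
    extendedPoisson c {n | n = 0} = EReal.exp (-(c : EReal)) := by
  unfold extendedPoisson
  split_ifs with h
  · subst h
    simp
  · have hpre : (Nat.cast : ℕ → ℕ∞) ⁻¹' {n | n = 0} = {0} := by ext; simp
    rw [Measure.map_apply .of_discrete .of_discrete, hpre, poissonMeasure_singleton]
    lift c to ℝ≥0 using h
    have : -((c : ℝ≥0∞) : EReal) = ((-(c : ℝ) : ℝ) : EReal) := by
      rw [EReal.coe_neg]
      rfl
    rw [this, EReal.exp_coe]
    simp

/-- Since `exp (-c) ≥ 1 - c`, one has `1 - exp (-c) * (1 + c) ≤ 1 - (1 - c) * (1 + c) = c ^ 2`. -/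
theorem extendedPoisson_two_le (c : ℝ≥0∞) : extendedPoisson c {n | 2 ≤ n} ≤ c ^ 2 := by
  unfold extendedPoisson
  split_ifs with h
  · subst h
    simp
  · have hpre : (Nat.cast : ℕ → ℕ∞) ⁻¹' {n | 2 ≤ n} = ({0, 1} : Set ℕ)ᶜ := by
      ext n
      have : (2 : ℕ∞) ≤ n ↔ 2 ≤ n := by exact_mod_cast Iff.rfl
      simp only [mem_preimage, mem_ofPred_eq, this, mem_compl_iff, mem_insert_iff,
        mem_singleton_iff]
      omega
    lift c to ℝ≥0 using h
    have h01 : poissonMeasure c {0, 1} = ENNReal.ofReal (Real.exp (-c) * (1 + c)) := by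
      rw [insert_eq, measure_union (by simp) (measurableSet_singleton 1), poissonMeasure_singleton,
        poissonMeasure_singleton, ← ENNReal.ofReal_add (by positivity) (by positivity)]
      congr 1
      simp
      ring
    rw [Measure.map_apply .of_discrete .of_discrete, hpre, ENNReal.toNNReal_coe,
      prob_compl_eq_one_sub .of_discrete, h01, ← ENNReal.ofReal_one,
      ← ENNReal.ofReal_sub _ (by positivity), ← ENNReal.ofReal_coe_nnreal,
      ← ENNReal.ofReal_pow c.coe_nonneg]
    refine ENNReal.ofReal_le_ofReal ?_
    have h1 := Real.add_one_le_exp (-(c : ℝ))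
    nlinarith [c.2]

theorem pointCount_eq_zero_iff {Ω E : Type*} {X : ℕ → Ω → E} {A : Set E} {ω : Ω} : pointCount X A ω = 0 ↔ ∀ i, X i ω ∉ A := by
  simp [pointCount, encard_eq_zero, eq_empty_iff_forall_notMem]

theorem two_le_pointCount {Ω E : Type*} {X : ℕ → Ω → E} {A : Set E} {ω : Ω} {i j : ℕ} (hij : i ≠ j) (hi : X i ω ∈ A)
    (hj : X j ω ∈ A) : 2 ≤ pointCount X A ω := by
  rw [← encard_pair hij, pointCount]
  refine encard_le_encard ?_
  rintro k (rfl | rfl)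
  exacts [hi, hj]

variable {Ω E : Type*} [MeasurableSpace Ω] [MeasurableSpace E] {X : ℕ → Ω → E} {μ : Measure E}
  {P : Measure Ω}

namespace IsPoissonPointProcess

theorem measure_forall_notMem (hX : IsPoissonPointProcess X μ P) {A : Set E}
    (hA : MeasurableSet A) : P {ω | ∀ i, X i ω ∉ A} = EReal.exp (-(μ A : EReal)) := by
  rw [← extendedPoisson_zero, ← (hX.hasLaw_count A hA).measure_eq .of_discrete]
  simp_rw [pointCount_eq_zero_iff]

theorem measure_exists_ne_le (hX : IsPoissonPointProcess X μ P) {A : Set E}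
    (hA : MeasurableSet A) : P {ω | ∃ i j, i ≠ j ∧ X i ω ∈ A ∧ X j ω ∈ A} ≤ μ A ^ 2 := by
  refine le_trans (measure_mono ?_) (((hX.hasLaw_count A hA).measure_eq
    (p := fun n => 2 ≤ n) .of_discrete).trans_le (extendedPoisson_two_le _))
  rintro ω ⟨i, j, hij, hi, hj⟩
  exact two_le_pointCount hij hi hj

theorem ae_exists_mem (hX : IsPoissonPointProcess X μ P) {A : Set E}
    (hA : MeasurableSet A) (h : μ A = ∞) : ∀ᵐ ω ∂P, ∃ i, X i ω ∈ A := by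
  have := hX.measure_forall_notMem hA
  rw [h] at this
  rw [ae_iff]
  simpa using this

end IsPoissonPointProcess

end Poisson

/-! ### Reduction of the supremum to the noise points -/

section ShotNoise

variable {Ω : Type*} [MeasurableSpace Ω] {P : Measure Ω} {X : ℕ → Ω → ℝ≥0 × ℝ≥0} {H κ : ℝ}

/-- Cut time into cells of length `1/(n+1)`. Simultaneous points fall into one cell, which has
probability `O(n⁻²)` per cell, hence `O(n⁻¹)` over all the cells. -/
theorem measure_exists_simultaneous_gt_eq_zero (hH : 0 < H)
    (hX : IsPoissonPointProcess X (shotNoiseIntensity H) P) {ε : ℝ} (hε : 0 < ε) :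
    P {ω | ∃ i j, i ≠ j ∧ (X i ω).2 = (X j ω).2 ∧ (X i ω).2 ≤ 1 ∧ ε < (X i ω).1 ∧
      ε < (X j ω).1} = 0 := by
  -- The factor `1` is `κ`: the formula for the intensity above a level is applied with `κ = 1`.
  set c : ℝ := 1 * ε ^ (-(1 / H)) with hc
  have hc0 : 0 ≤ c := by positivity
  let J : ℕ → ℕ → Set ℝ≥0 := fun n k => Ico ((k : ℝ≥0) / (n + 1)) ((k + 1 : ℝ≥0) / (n + 1))
  let A : ℕ → ℕ → Set (ℝ≥0 × ℝ≥0) := fun n k => {p | p.2 ∈ J n k ∧ ε < (1 : ℝ) ^ H * p.1}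
  have hA : ∀ n k, MeasurableSet (A n k) := fun n k =>
    (measurable_snd measurableSet_Ico).inter
      (measurableSet_lt measurable_const (measurable_const.mul measurable_fst.coe_nnreal_real))
  have hμ : ∀ n k, shotNoiseIntensity H (A n k) ≤ ENNReal.ofReal (c * (1 / ((n : ℝ) + 1))) := by
    intro n k
    rw [shotNoiseIntensity_above hH one_pos measurable_const measurableSet_Ico,
      setLIntegral_const, noiseTail_of_pos one_pos hε, ENNReal.ofReal_mul hc0]
    gcongr
    refine (lebesgueNNReal_Ico_le _ _).trans (ENNReal.ofReal_le_ofReal (le_of_eq ?_))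
    push_cast
    ring
  have hbound : ∀ n : ℕ, P {ω | ∃ i j, i ≠ j ∧ (X i ω).2 = (X j ω).2 ∧ (X i ω).2 ≤ 1 ∧
      ε < (X i ω).1 ∧ ε < (X j ω).1} ≤ ENNReal.ofReal (2 * c ^ 2 * (1 / ((n : ℝ) + 1))) := by
    intro n
    calc _ ≤ P (⋃ k ∈ Finset.range (n + 2), {ω | ∃ i j, i ≠ j ∧ X i ω ∈ A n k ∧ X j ω ∈ A n k}) := by
          refine measure_mono ?_
          rintro ω ⟨i, j, hij, hU, h1, hi, hj⟩
          have hn : (0 : ℝ≥0) < n + 1 := by positivity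
          have hmem : (X i ω).2 ∈ J n ⌊(X i ω).2 * (n + 1)⌋₊ := by
            refine ⟨?_, ?_⟩
            · rw [div_le_iff₀ hn]; exact Nat.floor_le zero_le
            · rw [lt_div_iff₀ hn]; exact Nat.lt_floor_add_one _
          -- There are `n + 2` cells, not `n + 1`, because time `1` lies in the cell with index `n +
          -- 1`.
          have hk : ⌊(X i ω).2 * (n + 1)⌋₊ < n + 2 := by
            have : ⌊(X i ω).2 * (n + 1)⌋₊ ≤ n + 1 := by
              refine Nat.floor_le_of_le ?_
              push_cast
              exact mul_le_of_le_one_left zero_le h1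
            omega
          simp only [mem_iUnion, Finset.mem_range]
          refine ⟨_, hk, i, j, hij, ⟨hmem, ?_⟩, ⟨hU ▸ hmem, ?_⟩⟩
          · simpa using hi
          · simpa using hj
      _ ≤ ∑ k ∈ Finset.range (n + 2), P {ω | ∃ i j, i ≠ j ∧ X i ω ∈ A n k ∧ X j ω ∈ A n k} :=
          measure_biUnion_finset_le _ _
      _ ≤ ∑ k ∈ Finset.range (n + 2), ENNReal.ofReal ((c * (1 / ((n : ℝ) + 1))) ^ 2) := by
          refine Finset.sum_le_sum fun k _ => (hX.measure_exists_ne_le (hA n k)).trans ?_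
          rw [ENNReal.ofReal_pow (by positivity)]
          exact pow_le_pow_left' (hμ n k) 2
      _ = ENNReal.ofReal ((n + 2) * (c * (1 / ((n : ℝ) + 1))) ^ 2) := by
          rw [Finset.sum_const, Finset.card_range, nsmul_eq_mul,
            ENNReal.ofReal_mul (by positivity)]
          congr 1
          rw [show ((n : ℝ) + 2) = ((n + 2 : ℕ) : ℝ) by push_cast; ring, ENNReal.ofReal_natCast]
      _ ≤ _ := by
          refine ENNReal.ofReal_le_ofReal ?_
          have hn : (0 : ℝ) < n + 1 := by positivity
          rw [show ((n : ℝ) + 2) * (c * (1 / ((n : ℝ) + 1))) ^ 2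
            = (((n : ℝ) + 2) / (n + 1)) * c ^ 2 * (1 / ((n : ℝ) + 1)) by field_simp]
          gcongr
          rw [div_le_iff₀ hn]
          have : (0 : ℝ) ≤ n := by positivity
          linarith
  have hlim : Tendsto (fun n : ℕ => ENNReal.ofReal (2 * c ^ 2 * (1 / ((n : ℝ) + 1)))) atTop
      (𝓝 0) := by
    rw [← ENNReal.ofReal_zero]
    refine ENNReal.tendsto_ofReal ?_
    simpa using (tendsto_one_div_add_atTop_nhds_zero_nat (𝕜 := ℝ)).const_mul (2 * c ^ 2)
  exact le_antisymm (ge_of_tendsto' hlim hbound) zero_le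

theorem ae_simple_points (hH : 0 < H)
    (hX : IsPoissonPointProcess X (shotNoiseIntensity H) P) :
    ∀ᵐ ω ∂P, ∀ i j, (X i ω).2 = (X j ω).2 → (X i ω).2 ≤ 1 → 0 < (X i ω).1 → 0 < (X j ω).1 →
      i = j := by
  have h : ∀ n : ℕ, ∀ᵐ ω ∂P, ¬ ∃ i j, i ≠ j ∧ (X i ω).2 = (X j ω).2 ∧ (X i ω).2 ≤ 1 ∧
      1 / ((n : ℝ) + 1) < (X i ω).1 ∧ 1 / ((n : ℝ) + 1) < (X j ω).1 := fun n => by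
    rw [ae_iff]
    simpa only [not_not] using measure_exists_simultaneous_gt_eq_zero hH hX
      (ε := 1 / ((n : ℝ) + 1)) (by positivity)
  filter_upwards [ae_all_iff.2 h] with ω hω i j hU h1 hi hj
  by_contra hij
  obtain ⟨n, hn⟩ := exists_nat_one_div_lt (K := ℝ) (ε := min (X i ω).1 (X j ω).1)
    (by simpa using ⟨hi, hj⟩)
  exact hω n ⟨i, j, hij, hU, h1, hn.trans_le (by simp), hn.trans_le (by simp)⟩

/-- A time set of positive length carries infinite intensity because of the small points, so it
almost surely contains a point; a countable basis makes the null set uniform. -/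
theorem ae_dense_points (hH : 0 < H)
    (hX : IsPoissonPointProcess X (shotNoiseIntensity H) P) :
    ∀ᵐ ω ∂P, ∀ U : Set ℝ≥0, IsOpen U → ∀ u ∈ U, u ≤ 1 → ∃ i, (X i ω).2 ∈ U ∧ (X i ω).2 ≤ 1 := by
  have h : ∀ V ∈ TopologicalSpace.countableBasis ℝ≥0, ∀ᵐ ω ∂P,
      (V ∩ Iic 1).Nonempty → ∃ i, (X i ω).2 ∈ V ∩ Iic 1 := by
    intro V hV
    by_cases hne : (V ∩ Iic 1).Nonempty
    swap
    · simp [hne]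
    have hVo := TopologicalSpace.isOpen_of_mem_countableBasis hV
    have hms : MeasurableSet (V ∩ Iic 1) := hVo.measurableSet.inter measurableSet_Iic
    obtain ⟨u, huV, hu1⟩ := hne
    -- The level `-1` imposes no restriction on the height.
    have key := shotNoiseIntensity_above hH one_pos (f := fun _ => -1) measurable_const hms
    rw [noiseTail_of_nonpos hH one_pos (by norm_num), setLIntegral_const,
      ENNReal.top_mul (lebesgueNNReal_inter_Iic_one_pos hVo huV hu1).ne'] at key
    have := hX.ae_exists_mem ((measurable_snd hms).inter (measurableSet_lt measurable_const
      (measurable_const.mul measurable_fst.coe_nnreal_real))) key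
    filter_upwards [this] with ω hω _
    obtain ⟨i, hi⟩ := hω
    exact ⟨i, hi.1⟩
  filter_upwards [(ae_ball_iff (TopologicalSpace.countable_countableBasis ℝ≥0)).2 h]
    with ω hω U hU u hu hu1
  obtain ⟨V, hV, huV, hVU⟩ :=
    (TopologicalSpace.isBasis_countableBasis ℝ≥0).exists_subset_of_mem_open hu hU
  obtain ⟨i, hi⟩ := hω V hV ⟨u, huV, hu1⟩
  exact ⟨i, hVU hi.1, hi.2⟩

theorem le_shotNoise {Ω : Type*} {X : ℕ → Ω → ℝ≥0 × ℝ≥0} (i : ℕ) (ω : Ω) : ((X i ω).1 : ℝ≥0∞) ≤ shotNoise X (X i ω).2 ω := by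
  classical
  refine le_trans ?_ (ENNReal.le_tsum i)
  simp

theorem shotNoise_eq_zero_or {Ω : Type*} {X : ℕ → Ω → ℝ≥0 × ℝ≥0} {ω : Ω} {s : ℝ≥0}
    (h : ∀ i j, (X i ω).2 = s → (X j ω).2 = s → 0 < (X i ω).1 → 0 < (X j ω).1 → i = j) :
    shotNoise X s ω = 0 ∨ ∃ i, (X i ω).2 = s ∧ shotNoise X s ω = (X i ω).1 := by
  classical
  by_cases hex : ∃ i, (X i ω).2 = s ∧ 0 < (X i ω).1
  · obtain ⟨i, hi, hpos⟩ := hex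
    refine .inr ⟨i, hi, ?_⟩
    rw [shotNoise, tsum_eq_single i]
    · simp [hi]
    · intro j hj
      by_cases hjs : (X j ω).2 = s
      · rcases eq_or_ne (X j ω).1 0 with h0 | h0
        · simp [h0]
        · exact absurd (h j i hjs hi (pos_iff_ne_zero.2 h0) hpos) hj
      · simp [hjs]
  · push Not at hex
    left
    rw [shotNoise, ENNReal.tsum_eq_zero]
    intro i
    split_ifs with hi
    · exact_mod_cast le_antisymm (hex i hi) zero_le
    · rfl

theorem add_ofReal_mul_le_iff (hκ : 0 < κ) (b y : ℝ) (x : ℝ≥0) :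
    (b : EReal) + ((ENNReal.ofReal (κ ^ H) * (x : ℝ≥0∞) : ℝ≥0∞) : EReal) ≤ y ↔
      κ ^ H * x ≤ y - b := by
  have hκH : 0 ≤ κ ^ H := Real.rpow_nonneg hκ.le H
  rw [← ENNReal.ofReal_coe_nnreal, ← ENNReal.ofReal_mul hκH, EReal.coe_ennreal_ofReal,
    max_eq_left (by positivity)]
  norm_cast
  rw [le_sub_iff_add_le']

/-- By simplicity the noise at any time in `[0, 1]` is zero or a single height. At times without
noise the bound `B s ≤ y` still follows, by continuity, from the bounds at the dense point times. -/
theorem maxProcess_le_iff {Ω : Type*} {X : ℕ → Ω → ℝ≥0 × ℝ≥0} (hκ : 0 < κ) {B : ℝ≥0 → Ω → ℝ} {ω : Ω}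
    (hB : Continuous fun t => B t ω)
    (hs : ∀ i j, (X i ω).2 = (X j ω).2 → (X i ω).2 ≤ 1 → 0 < (X i ω).1 → 0 < (X j ω).1 → i = j)
    (hd : ∀ U : Set ℝ≥0, IsOpen U → ∀ u ∈ U, u ≤ 1 → ∃ i, (X i ω).2 ∈ U ∧ (X i ω).2 ≤ 1)
    (y : ℝ) :
    maxProcess H κ B X 1 ω ≤ y ↔
      ∀ i, (X i ω).2 ≤ 1 → κ ^ H * (X i ω).1 ≤ y - B (X i ω).2 ω := by
  have hκH : 0 ≤ κ ^ H := Real.rpow_nonneg hκ.le H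
  simp only [maxProcess, iSup_le_iff]
  constructor
  · intro h i hi
    rw [← add_ofReal_mul_le_iff hκ]
    refine le_trans ?_ (h (X i ω).2 ⟨zero_le, hi⟩)
    exact add_le_add le_rfl (EReal.coe_ennreal_le_coe_ennreal_iff.2
      (mul_le_mul_right (le_shotNoise i ω) _))
  · intro h s hs1
    have hBs : B s ω ≤ y := by
      by_contra! hlt
      obtain ⟨i, hi, hi1⟩ := hd {u | y < B u ω} (isOpen_lt continuous_const hB) s hlt hs1.2
      have h1 := h i hi1
      have h2 : y < B (X i ω).2 ω := hi
      have h3 : 0 ≤ κ ^ H * (X i ω).1 := by positivity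
      linarith
    have hs' : ∀ i j, (X i ω).2 = s → (X j ω).2 = s → 0 < (X i ω).1 → 0 < (X j ω).1 → i = j :=
      fun i j hi hj => hs i j (hi.trans hj.symm) (hi ▸ hs1.2)
    rcases shotNoise_eq_zero_or hs' with h0 | ⟨i, hi, h0⟩
    · rw [h0]
      simpa using hBs
    · rw [h0, add_ofReal_mul_le_iff hκ]
      subst hi
      exact h i hs1.2

end ShotNoise

/-! ### Fubini for independent variables -/

section IndepFun

variable {Ω E F : Type*} [MeasurableSpace Ω] [MeasurableSpace E] [MeasurableSpace F]
  {P : Measure Ω} [IsFiniteMeasure P] {f : Ω → E} {g : Ω → F}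

theorem ProbabilityTheory.IndepFun.measure_eq_lintegral_measure (h : IndepFun f g P)
    (hf : Measurable f) (hg : Measurable g) {S : Set (E × F)} (hS : MeasurableSet S) :
    P {ω | (f ω, g ω) ∈ S} = ∫⁻ ω, P {ω' | (f ω, g ω') ∈ S} ∂P := by
  have h1 : P {ω | (f ω, g ω) ∈ S} = P.map (fun ω => (f ω, g ω)) S :=
    (Measure.map_apply (hf.prodMk hg) hS).symm
  rw [h1, h.map_prod_eq_prod_map_map hf.aemeasurable hg.aemeasurable, Measure.prod_apply hS,
    lintegral_map (measurable_measure_prodMk_left hS) hf]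
  refine lintegral_congr fun ω => ?_
  rw [Measure.map_apply hg (measurable_prodMk_left hS)]
  rfl

end IndepFun

/-! ### Countable tests for continuous paths -/

section DenseTimes

/-- A sequence of times that is dense in `[0, 1]`. -/
noncomputable def unitSeq (n : ℕ) : ℝ≥0 := min (TopologicalSpace.denseSeq ℝ≥0 n) 1

theorem unitSeq_le_one (n : ℕ) : unitSeq n ≤ 1 := min_le_right _ _

/-- Membership is tested at the untruncated point and `b` at the truncated one: `u ↦ b (min u 1)` is
continuous on the whole half-line, so density in `ℝ≥0` suffices. -/
theorem forall_le_of_forall_unitSeq {V : Set ℝ≥0} (hV : IsOpen V) {b : ℝ≥0 → ℝ}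
    (hb : Continuous b) {y : ℝ}
    (h : ∀ n, TopologicalSpace.denseSeq ℝ≥0 n ∈ V → y ≤ b (unitSeq n)) {u : ℝ≥0} (hu : u ∈ V)
    (hu1 : u ≤ 1) : y ≤ b u := by
  have hc : Continuous fun u : ℝ≥0 => b (min u 1) := by fun_prop
  by_contra! hlt
  have hopen : IsOpen (V ∩ {u | b (min u 1) < y}) := hV.inter (isOpen_lt hc continuous_const)
  obtain ⟨n, hn⟩ := (TopologicalSpace.denseRange_denseSeq ℝ≥0).exists_mem_open hopen
    ⟨u, hu, by simpa [min_eq_left hu1] using hlt⟩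
  exact absurd (h n hn.1) (not_le.2 hn.2)

theorem forall_unitSeq_le_iff {b : ℝ≥0 → ℝ} (hb : Continuous b) {y : ℝ} :
    (∀ n, b (unitSeq n) ≤ y) ↔ ∀ u ≤ 1, b u ≤ y := by
  refine ⟨fun h u hu => ?_, fun h n => h _ (unitSeq_le_one n)⟩
  exact neg_le_neg_iff.1 (forall_le_of_forall_unitSeq isOpen_univ hb.neg
    (fun n _ => neg_le_neg (h n)) (mem_univ u) hu)

end DenseTimes

/-! ### The distribution function as an expected void probability -/

section VoidFormula

variable {Ω : Type*} [MeasurableSpace Ω] {P : Measure Ω} [IsProbabilityMeasure P]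
  {X : ℕ → Ω → ℝ≥0 × ℝ≥0} {H κ : ℝ} {B : ℝ≥0 → Ω → ℝ}

/-- The region of the points `(x, u)` with `u ∈ V ∩ [0, 1]` and `q < κ ^ H * x`. -/
def noiseStrip (H κ : ℝ) (r : ℚ × TopologicalSpace.countableBasis ℝ≥0) : Set (ℝ≥0 × ℝ≥0) :=
  {p | p.2 ∈ (r.2 : Set ℝ≥0) ∩ Iic 1 ∧ (r.1 : ℝ) < κ ^ H * p.1}

theorem measurableSet_noiseStrip (H κ : ℝ) (r : ℚ × TopologicalSpace.countableBasis ℝ≥0) :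
    MeasurableSet (noiseStrip H κ r) :=
  (measurable_snd ((TopologicalSpace.isOpen_of_mem_countableBasis r.2.2).measurableSet.inter
    measurableSet_Iic)).inter
    (measurableSet_lt measurable_const (measurable_const.mul measurable_fst.coe_nnreal_real))

/-- The strip `r` lies above the graph of `y - b`. -/
def StripAbove (y : ℝ) (b : ℝ≥0 → ℝ) (r : ℚ × TopologicalSpace.countableBasis ℝ≥0) : Prop :=
  ∀ n, TopologicalSpace.denseSeq ℝ≥0 n ∈ (r.2 : Set ℝ≥0) → y - r.1 ≤ b (unitSeq n)

/-- The region above the graph of `y - b` is a countable union of strips with rational height and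
basic open base. Avoiding it thus depends on countably many coordinates of the path and countably
many counts, which makes it measurable for the product σ-algebras. -/
theorem forall_strip_notMem_iff {b : ℝ≥0 → ℝ} (hb : Continuous b) {y : ℝ}
    {x : ℕ → ℝ≥0 × ℝ≥0} :
    (∀ r, StripAbove y b r → ∀ i, x i ∉ noiseStrip H κ r) ↔
      ∀ i, x i ∉ {p : ℝ≥0 × ℝ≥0 | p.2 ∈ Iic 1 ∧ y - b p.2 < κ ^ H * p.1} := by
  constructor
  · rintro h i ⟨h1, hlt⟩
    obtain ⟨q, hq1, hq2⟩ := exists_rat_btwn hlt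
    have hopen : IsOpen {u | y - q < b (min u 1)} := isOpen_lt continuous_const (by fun_prop)
    obtain ⟨V, hV, hxV, hVsub⟩ :=
      (TopologicalSpace.isBasis_countableBasis ℝ≥0).exists_subset_of_mem_open
        (a := (x i).2) (by
          change y - q < b (min (x i).2 1)
          rw [min_eq_left h1]
          linarith) hopen
    refine h (q, ⟨V, hV⟩) (fun n hn => ?_) i ⟨⟨hxV, h1⟩, hq2⟩
    exact le_of_lt (hVsub hn)
  · rintro h r hr i ⟨⟨hV, h1⟩, hlt⟩
    refine h i ⟨h1, ?_⟩
    have := forall_le_of_forall_unitSeq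
      (TopologicalSpace.isOpen_of_mem_countableBasis r.2.2) hb hr hV h1
    linarith

/-- The mean number of noise points that lift the path `b` above the level `y` before time `1`. -/
noncomputable def exceedanceMass (H κ y : ℝ) (b : ℝ≥0 → ℝ) : ℝ≥0∞ :=
  ∫⁻ u in Iic 1, noiseTail H κ (y - b u) ∂lebesgueNNReal

theorem measure_forall_le_sub (hH : 0 < H) (hκ : 0 < κ) (hBm : ∀ t, Measurable (B t))
    (hBc : ∀ ω, Continuous fun t => B t ω)
    (hX : IsPoissonPointProcess X (shotNoiseIntensity H) P) (hBX : IndepOfPointProcess B X P)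
    (y : ℝ) :
    P {ω | ∀ i, (X i ω).2 ≤ 1 → κ ^ H * (X i ω).1 ≤ y - B (X i ω).2 ω} =
      ∫⁻ ω, EReal.exp (-(exceedanceMass H κ y (B · ω) : EReal)) ∂P := by
  let ι := ℚ × TopologicalSpace.countableBasis ℝ≥0
  have : Countable (TopologicalSpace.countableBasis ℝ≥0) :=
    (TopologicalSpace.countable_countableBasis ℝ≥0).to_subtype
  let f : Ω → ℝ≥0 → ℝ := fun ω t => B t ω
  let g : Ω → ι → Prop := fun ω r => ∀ i, X i ω ∉ noiseStrip H κ r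
  have hf : Measurable f := measurable_pi_lambda _ hBm
  have hg : Measurable g := measurable_pi_lambda _ fun r => by
    refine Measurable.forall fun i => Measurable.not ?_
    exact measurableSet_setOfPred.1 (hX.measurable i (measurableSet_noiseStrip H κ r))
  have hind : IndepFun f g P := by
    -- Independence is given for counts, so avoiding a strip is rewritten as a zero count.
    have hcomp := hBX.comp (φ := id)
      (ψ := fun (N : {A : Set (ℝ≥0 × ℝ≥0) // MeasurableSet A} → ℕ∞) (r : ι) =>
        N ⟨noiseStrip H κ r, measurableSet_noiseStrip H κ r⟩ = 0) measurable_id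
      (measurable_pi_lambda _ fun r => (Measurable.of_discrete (f := fun n : ℕ∞ => n = 0)).comp
        (measurable_pi_apply _))
    have hgeq : g = fun ω r => pointCount X (noiseStrip H κ r) ω = 0 := by
      funext ω r
      exact propext pointCount_eq_zero_iff.symm
    rw [hgeq]
    exact hcomp
  have hS : MeasurableSet {p : (ℝ≥0 → ℝ) × (ι → Prop) | ∀ r, StripAbove y p.1 r → p.2 r} := by
    refine measurableSet_setOfPred.2 (Measurable.forall fun r => Measurable.imp ?_ ?_)
    · refine Measurable.forall fun n => Measurable.imp measurable_const ?_
      exact measurableSet_setOfPred.1 (measurableSet_le measurable_const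
        ((measurable_pi_apply _).comp measurable_fst))
    · exact (measurable_pi_apply r).comp measurable_snd
  have hvoid : ∀ ω ω', ((f ω, g ω') ∈
      {p : (ℝ≥0 → ℝ) × (ι → Prop) | ∀ r, StripAbove y p.1 r → p.2 r}) ↔
      ∀ i, X i ω' ∉ {p : ℝ≥0 × ℝ≥0 | p.2 ∈ Iic 1 ∧ y - B p.2 ω < κ ^ H * p.1} :=
    fun ω ω' => forall_strip_notMem_iff (x := fun i => X i ω') (hBc ω)
  have key := hind.measure_eq_lintegral_measure hf hg hS
  simp only [hvoid] at key
  trans P {ω | ∀ i, X i ω ∉ {p : ℝ≥0 × ℝ≥0 | p.2 ∈ Iic 1 ∧ y - B p.2 ω < κ ^ H * p.1}}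
  · congr 1
    ext ω
    simp
  rw [key]
  refine lintegral_congr fun ω => ?_
  have hm : Measurable fun u => y - B u ω := (continuous_const.sub (hBc ω)).measurable
  rw [hX.measure_forall_notMem, shotNoiseIntensity_above hH hκ hm measurableSet_Iic]
  · rfl
  · exact (measurable_snd measurableSet_Iic).inter (measurableSet_lt (hm.comp measurable_snd)
      (measurable_const.mul measurable_fst.coe_nnreal_real))

theorem marginalCDF_eq (hH : 0 < H) (hκ : 0 < κ) (hBm : ∀ t, Measurable (B t))
    (hBc : ∀ ω, Continuous fun t => B t ω)
    (hX : IsPoissonPointProcess X (shotNoiseIntensity H) P) (hBX : IndepOfPointProcess B X P)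
    (y : ℝ) :
    marginalCDF H κ B X P y =
      (∫⁻ ω, EReal.exp (-(exceedanceMass H κ y (B · ω) : EReal)) ∂P).toReal := by
  rw [marginalCDF, Measure.real, ← measure_forall_le_sub hH hκ hBm hBc hX hBX]
  congr 1
  refine measure_congr ?_
  filter_upwards [ae_simple_points hH hX, ae_dense_points hH hX] with ω hs hd
  exact propext (maxProcess_le_iff hκ (hBc ω) hs hd y)

end VoidFormula

/-! ### Maximum of a path as a function of its endpoint coefficient -/

section PathLemmas

variable {Y c : ℝ≥0 → ℝ} {y : ℝ}

/-- The set encodes `max (Y + c * x) = y` through countably many times. Such a maximum is not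
attained at time `0`, where the path is `0 < y`; elsewhere `c > 0`, so increasing `x` pushes the
path above `y`. -/
theorem subsingleton_setOf_sup_add_mul_eq (hY : Continuous Y) (hY0 : Y 0 = 0) (hc : Continuous c)
    (hc0 : c 0 = 0) (hcpos : ∀ u, 0 < u → u ≤ 1 → 0 < c u) (hy : 0 < y) :
    {x : ℝ | (∀ n, Y (unitSeq n) + c (unitSeq n) * x ≤ y) ∧
      ∀ m : ℕ, ∃ n, y - 1 / ((m : ℝ) + 1) < Y (unitSeq n) + c (unitSeq n) * x}.Subsingleton := by
  have key : ∀ x₁ x₂ : ℝ, x₁ < x₂ →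
      (∀ m : ℕ, ∃ n, y - 1 / ((m : ℝ) + 1) < Y (unitSeq n) + c (unitSeq n) * x₁) →
      ¬ ∀ n, Y (unitSeq n) + c (unitSeq n) * x₂ ≤ y := by
    intro x₁ x₂ hx h1 h2
    have hcont : ∀ x : ℝ, Continuous fun u => Y u + c u * x := fun x => by fun_prop
    rw [forall_unitSeq_le_iff (b := fun u => Y u + c u * x₂) (hcont x₂)] at h2
    obtain ⟨u, hu, hmax⟩ := (isCompact_Icc (a := (0 : ℝ≥0)) (b := 1)).exists_isMaxOn
      ⟨0, le_rfl, zero_le_one⟩ (hcont x₁).continuousOn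
    have hge : y ≤ Y u + c u * x₁ := by
      by_contra! hlt
      obtain ⟨m, hm⟩ := exists_nat_one_div_lt (sub_pos.2 hlt)
      obtain ⟨n, hn⟩ := h1 m
      have h3 : Y (unitSeq n) + c (unitSeq n) * x₁ ≤ Y u + c u * x₁ :=
        hmax ⟨zero_le, unitSeq_le_one n⟩
      linarith
    have hupos : 0 < u := by
      rw [pos_iff_ne_zero]
      rintro rfl
      rw [hY0, hc0] at hge
      linarith
    have h4 := h2 u hu.2
    nlinarith [hcpos u hupos hu.2]
  rintro x₁ ⟨h1, h1'⟩ x₂ ⟨h2, h2'⟩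
  rcases lt_trichotomy x₁ x₂ with h | h | h
  · exact absurd h2 (key _ _ h h1')
  · exact h
  · exact absurd h1 (key _ _ h h2')

/-- Only the compact set `{Y ≥ y}` is critical. It avoids time `0`, so `(y - Y) / c` is continuous
and bounded below on it; elsewhere `x ≤ 0` suffices. -/
theorem exists_forall_lt_add_mul_le (hY : Continuous Y) (hY0 : Y 0 = 0) (hc : Continuous c)
    (hc0 : c 0 = 0) (hcpos : ∀ u, 0 < u → u ≤ 1 → 0 < c u) (hy : 0 < y) :
    ∃ K : ℝ, ∀ x < K, ∀ u ≤ 1, Y u + c u * x ≤ y := by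
  have hcnn : ∀ u ≤ 1, 0 ≤ c u := fun u hu => by
    rcases eq_or_ne u 0 with rfl | h
    · exact hc0.ge
    · exact (hcpos u (pos_iff_ne_zero.2 h) hu).le
  let C : Set ℝ≥0 := Icc 0 1 ∩ {u | y ≤ Y u}
  have hC : IsCompact C := isCompact_Icc.inter_right (isClosed_le continuous_const hY)
  have hCpos : ∀ u ∈ C, 0 < c u := fun u hu => by
    refine hcpos u (pos_iff_ne_zero.2 ?_) hu.1.2
    rintro rfl
    have : y ≤ Y 0 := hu.2
    linarith
  have hcont : ContinuousOn (fun u => (y - Y u) / c u) C :=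
    (continuous_const.sub hY).continuousOn.div hc.continuousOn fun u hu => (hCpos u hu).ne'
  obtain ⟨K, hK⟩ := hC.bddBelow_image hcont
  refine ⟨min K 0, fun x hx u hu => ?_⟩
  by_cases huC : y ≤ Y u
  · have hmem : u ∈ C := ⟨⟨zero_le, hu⟩, huC⟩
    have h1 : K ≤ (y - Y u) / c u := hK (mem_image_of_mem _ hmem)
    have h2 : x ≤ (y - Y u) / c u := (hx.le.trans (min_le_left _ _)).trans h1
    rw [le_div_iff₀ (hCpos u hmem)] at h2
    linarith
  · have h1 : x ≤ 0 := hx.le.trans (min_le_right _ _)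
    nlinarith [hcnn u hu]

end PathLemmas

/-! ### Fractional Brownian motion: regression on `B 1` and the law of the maximum -/

namespace IsFractionalBrownianMotion

variable {Ω : Type*} [MeasurableSpace Ω] {P : Measure Ω} {H : ℝ}
  {B : ℝ≥0 → Ω → ℝ}

/-- The covariance of fractional Brownian motion at times `t` and `1`. -/
noncomputable def covOne (H : ℝ) (t : ℝ≥0) : ℝ :=
  ((t : ℝ) ^ (2 * H) + 1 - |(t : ℝ) - 1| ^ (2 * H)) / 2

theorem continuous_covOne (hH : 0 < H) : Continuous (covOne H) := by
  have h1 : Continuous fun x : ℝ => x ^ (2 * H) := Real.continuous_rpow_const (by positivity)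
  unfold covOne
  have h2 : Continuous fun t : ℝ≥0 => (t : ℝ) ^ (2 * H) := h1.comp NNReal.continuous_coe
  have h3 : Continuous fun t : ℝ≥0 => |(t : ℝ) - 1| ^ (2 * H) :=
    h1.comp ((NNReal.continuous_coe.sub continuous_const).abs)
  fun_prop

theorem covOne_zero (hH : 0 < H) : covOne H 0 = 0 := by
  have : 2 * H ≠ 0 := by positivity
  simp [covOne, Real.zero_rpow this]

theorem covOne_pos (hH : 0 < H) {t : ℝ≥0} (ht : 0 < t) (ht1 : t ≤ 1) : 0 < covOne H t := by
  have h0 : (0 : ℝ) < t := ht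
  have h1 : (t : ℝ) ≤ 1 := ht1
  have h2 : 0 < (t : ℝ) ^ (2 * H) := Real.rpow_pos_of_pos h0 _
  have h3 : |(t : ℝ) - 1| ^ (2 * H) ≤ 1 := by
    refine Real.rpow_le_one (abs_nonneg _) ?_ (by positivity)
    rw [abs_le]
    constructor <;> linarith
  unfold covOne
  linarith

theorem memLp_two (hB : IsFractionalBrownianMotion H B P) (t : ℝ≥0) : MemLp (B t) 2 P :=
  (hB.isGaussianProcess.hasGaussianLaw_eval t).memLp_two

theorem variance_eq (hB : IsFractionalBrownianMotion H B P) (hH : 0 < H) (t : ℝ≥0) :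
    Var[B t; P] = (t : ℝ) ^ (2 * H) := by
  have : 2 * H ≠ 0 := by positivity
  rw [← covariance_self (hB.measurable t).aemeasurable, hB.covariance_eq, sub_self, abs_zero,
    Real.zero_rpow this]
  ring

theorem covariance_one (hB : IsFractionalBrownianMotion H B P) (t : ℝ≥0) :
    cov[B t, B 1; P] = covOne H t := by
  rw [hB.covariance_eq]
  simp [covOne]

theorem map_one [IsProbabilityMeasure P] (hB : IsFractionalBrownianMotion H B P) (hH : 0 < H) :
    P.map (B 1) = gaussianReal 0 1 := by
  rw [(hB.isGaussianProcess.hasGaussianLaw_eval 1).map_eq_gaussianReal, hB.variance_eq hH,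
    hB.mean_zero]
  simp

theorem ae_zero [IsProbabilityMeasure P] (hB : IsFractionalBrownianMotion H B P) (hH : 0 < H) : ∀ᵐ ω ∂P, B 0 ω = 0 := by
  have hv : Var[B 0; P] = 0 := by
    have : 2 * H ≠ 0 := by positivity
    rw [hB.variance_eq hH]
    simp [Real.zero_rpow this]
  have h := (hB.isGaussianProcess.hasGaussianLaw_eval 0).map_eq_gaussianReal
  rw [hv, hB.mean_zero, Real.toNNReal_zero, gaussianReal_zero_var] at h
  have h2 : ∀ᵐ x ∂(P.map (B 0)), x = 0 := by
    rw [h]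
    exact (ae_dirac_iff (measurableSet_singleton (0 : ℝ))).2 rfl
  exact ae_of_ae_map (hB.measurable 0).aemeasurable h2

/-- Removing from fractional Brownian motion its regression on the value at time `1` leaves a
process that is independent of that value. -/
theorem indepFun_residual [IsProbabilityMeasure P] (hB : IsFractionalBrownianMotion H B P) (hH : 0 < H) :
    IndepFun (fun ω t => B t ω - covOne H t * B 1 ω) (B 1) P := by
  classical
  let R : ℝ≥0 → Ω → ℝ := fun t ω => B t ω - covOne H t * B 1 ω
  let V : Unit → Ω → ℝ := fun _ => B 1
  have hRm : ∀ t, Measurable (R t) := fun t =>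
    (hB.measurable t).sub ((hB.measurable 1).const_mul _)
  have hG : IsGaussianProcess (Sum.elim R V) P := by
    refine hB.isGaussianProcess.of_isGaussianProcess fun s => ?_
    rcases s with t | _
    · refine ⟨{t, 1}, .proj (R := ℝ) (φ := fun _ : ({t, 1} : Finset ℝ≥0) => ℝ) ⟨t, by simp⟩ -
        covOne H t • .proj (R := ℝ) (φ := fun _ : ({t, 1} : Finset ℝ≥0) => ℝ) ⟨1, by simp⟩,
        fun ω => ?_⟩
      simp [R]
    · refine ⟨{1}, .proj (R := ℝ) (φ := fun _ : ({1} : Finset ℝ≥0) => ℝ) ⟨1, by simp⟩,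
        fun ω => ?_⟩
      simp [V]
  have hind := hG.indepFun_of_covariance_eq_zero (fun t => (hRm t).aemeasurable)
    (fun _ => (hB.measurable 1).aemeasurable) fun t _ => by
      have h11 : cov[B 1, B 1; P] = 1 := by
        have : 2 * H ≠ 0 := by positivity
        rw [hB.covariance_eq]
        simp [Real.zero_rpow this]
      change cov[fun ω => B t ω - covOne H t * B 1 ω, B 1; P] = 0
      rw [covariance_fun_sub_left (hB.memLp_two t) ((hB.memLp_two 1).const_mul _) (hB.memLp_two 1),
        covariance_const_mul_left, h11, hB.covariance_one]
      ring
  exact hind.comp (φ := id) (ψ := fun v : Unit → ℝ => v ()) measurable_id (measurable_pi_apply ())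

theorem measurable_residual (hB : IsFractionalBrownianMotion H B P) :
    Measurable fun ω t => B t ω - covOne H t * B 1 ω :=
  measurable_pi_lambda _ fun t => (hB.measurable t).sub ((hB.measurable 1).const_mul _)

theorem measurable_eval_add_mul (n : ℕ) : Measurable fun p : (ℝ≥0 → ℝ) × ℝ =>
    p.1 (unitSeq n) + covOne H (unitSeq n) * p.2 :=
  ((measurable_pi_apply _).comp measurable_fst).add (measurable_snd.const_mul _)

/-- The maximum of fractional Brownian motion over `[0, 1]` has no atom in `(0, ∞)`. -/
theorem ae_not_max_eq [IsProbabilityMeasure P] (hB : IsFractionalBrownianMotion H B P) (hH : 0 < H)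
    (hBc : ∀ ω, Continuous fun t => B t ω) {y : ℝ} (hy : 0 < y) :
    ∀ᵐ ω ∂P, (∀ u ≤ 1, B u ω ≤ y) → ∀ u ≤ 1, B u ω < y := by
  let S : Set ((ℝ≥0 → ℝ) × ℝ) :=
    {p | (∀ n, p.1 (unitSeq n) + covOne H (unitSeq n) * p.2 ≤ y) ∧
      ∀ m : ℕ, ∃ n, y - 1 / ((m : ℝ) + 1) < p.1 (unitSeq n) + covOne H (unitSeq n) * p.2}
  have hS : MeasurableSet S := by
    refine MeasurableSet.inter (measurableSet_setOfPred.2 (Measurable.forall fun n => ?_))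
      (measurableSet_setOfPred.2 (Measurable.forall fun m => Measurable.exists fun n => ?_))
    · exact measurableSet_setOfPred.1 (measurableSet_le (measurable_eval_add_mul n)
        measurable_const)
    · exact measurableSet_setOfPred.1 (measurableSet_lt measurable_const
        (measurable_eval_add_mul n))
  -- `S` encodes that the maximum equals `y`. For a fixed residual path it leaves at most one value
  -- of `B 1`, a null set for the Gaussian law.
  have hzero : P {ω | ((fun t => B t ω - covOne H t * B 1 ω), B 1 ω) ∈ S} = 0 := by
    rw [(hB.indepFun_residual hH).measure_eq_lintegral_measure hB.measurable_residual
      (hB.measurable 1) hS]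
    refine lintegral_eq_zero_of_ae_eq_zero ?_
    filter_upwards [hB.ae_zero hH] with ω hω
    have hsub := subsingleton_setOf_sup_add_mul_eq
      (Y := fun t => B t ω - covOne H t * B 1 ω)
      ((hBc ω).sub ((continuous_covOne hH).mul continuous_const))
      (by simp [hω, covOne_zero hH]) (continuous_covOne hH) (covOne_zero hH)
      (fun u => covOne_pos hH) hy
    have hms : MeasurableSet {x | ((fun t => B t ω - covOne H t * B 1 ω), x) ∈ S} :=
      measurable_prodMk_left hS
    have h1 := Measure.map_apply (μ := P) (hB.measurable 1) hms
    rw [hB.map_one hH] at h1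
    refine h1.symm.trans ?_
    have := nullSingletonClass_gaussianReal (μ := 0) one_ne_zero
    exact Set.Subsingleton.measure_zero hsub _
  have hzero' := measure_eq_zero_iff_ae_notMem.1 hzero
  filter_upwards [hzero'] with ω hω hle
  by_contra! hex
  obtain ⟨u, hu, hge⟩ := hex
  refine hω ⟨fun n => ?_, fun m => ?_⟩
  · simpa using hle _ (unitSeq_le_one n)
  · by_contra! hall
    have : ∀ n, B (unitSeq n) ω ≤ y - 1 / ((m : ℝ) + 1) := fun n => by simpa using hall n
    have h2 := (forall_unitSeq_le_iff (hBc ω)).1 this u hu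
    have h3 : (0 : ℝ) < 1 / ((m : ℝ) + 1) := by positivity
    linarith

/-- Fractional Brownian motion stays below any positive level on `[0, 1]` with positive
probability. -/
theorem measure_forall_le_pos [IsProbabilityMeasure P] (hB : IsFractionalBrownianMotion H B P) (hH : 0 < H)
    (hBc : ∀ ω, Continuous fun t => B t ω) {y : ℝ} (hy : 0 < y) :
    0 < P {ω | ∀ u ≤ 1, B u ω ≤ y} := by
  let S : Set ((ℝ≥0 → ℝ) × ℝ) :=
    {p | ∀ n, p.1 (unitSeq n) + covOne H (unitSeq n) * p.2 ≤ y}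
  have hS : MeasurableSet S := by
    refine measurableSet_setOfPred.2 (Measurable.forall fun n => ?_)
    exact measurableSet_setOfPred.1 (measurableSet_le (measurable_eval_add_mul n)
      measurable_const)
  have hset : {ω | ∀ u ≤ 1, B u ω ≤ y} =
      {ω | ((fun t => B t ω - covOne H t * B 1 ω), B 1 ω) ∈ S} := by
    ext ω
    simp [S, ← forall_unitSeq_le_iff (hBc ω)]
  rw [hset, (hB.indepFun_residual hH).measure_eq_lintegral_measure hB.measurable_residual
      (hB.measurable 1) hS, pos_iff_ne_zero]
  intro h0
  have hmeas : Measurable fun ω =>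
      P {ω' | ((fun t => B t ω - covOne H t * B 1 ω), B 1 ω') ∈ S} := by
    have h1 := (measurable_measure_prodMk_left (ν := P.map (B 1)) hS).comp
      (hB.measurable_residual)
    convert h1 using 1
    funext ω
    exact (Measure.map_apply (hB.measurable 1) (measurable_prodMk_left hS)).symm
  rw [lintegral_eq_zero_iff hmeas] at h0
  -- If the probability were zero, some residual path starting at `0` would make `B 1 < K` null,
  -- although the Gaussian law charges every half-line.
  obtain ⟨ω, hω0, hω⟩ := ((hB.ae_zero hH).and h0).exists
  obtain ⟨K, hK⟩ := exists_forall_lt_add_mul_le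
    (Y := fun t => B t ω - covOne H t * B 1 ω)
    ((hBc ω).sub ((continuous_covOne hH).mul continuous_const))
    (by simp [hω0, covOne_zero hH]) (continuous_covOne hH) (covOne_zero hH)
    (fun u => covOne_pos hH) hy
  have h1 : P.map (B 1) (Iio K) = 0 := by
    rw [Measure.map_apply (hB.measurable 1) measurableSet_Iio]
    refine measure_mono_null (fun ω' hω' => ?_) hω
    exact fun n => hK _ hω' _ (unitSeq_le_one n)
  rw [hB.map_one hH] at h1
  have h2 := gaussianReal_absolutelyContinuous' 0 one_ne_zero h1
  simp at h2

end IsFractionalBrownianMotion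

/-! ### The map `c ↦ exp (-c)` on `[0, ∞]` -/

section ExpNeg

theorem continuous_exp_neg_coe_ennreal : Continuous fun c : ℝ≥0∞ => EReal.exp (-(c : EReal)) :=
  ENNReal.continuous_exp.comp (continuous_neg.comp continuous_coe_ennreal_ereal)

theorem strictAnti_exp_neg_coe_ennreal : StrictAnti fun c : ℝ≥0∞ => EReal.exp (-(c : EReal)) :=
  fun _ _ h => EReal.exp_strictMono
    (EReal.neg_lt_neg_iff.2 (EReal.coe_ennreal_lt_coe_ennreal_iff.2 h))

theorem exp_neg_coe_ennreal_le_one (c : ℝ≥0∞) : EReal.exp (-(c : EReal)) ≤ 1 := by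
  have := strictAnti_exp_neg_coe_ennreal.antitone (zero_le (a := c))
  simpa using this

theorem exp_neg_coe_ennreal_top : EReal.exp (-((∞ : ℝ≥0∞) : EReal)) = 0 := by simp

end ExpNeg

/-! ### The exceedance mass of a fixed continuous path -/

section ExceedanceMass

variable {H κ y : ℝ} {b : ℝ≥0 → ℝ}

theorem antitone_exceedanceMass (hH : 0 < H) (b : ℝ≥0 → ℝ) :
    Antitone fun y => exceedanceMass H κ y b := fun _ _ h =>
  lintegral_mono fun _ => antitone_noiseTail hH (sub_le_sub_right h _)

/-- By continuity the path exceeds `y` on a time set of positive length, where the integrand is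
infinite. -/
theorem exceedanceMass_eq_top (hH : 0 < H) (hκ : 0 < κ) (hb : Continuous b) {u : ℝ≥0}
    (hu : u ≤ 1) (hy : y < b u) : exceedanceMass H κ y b = ∞ := by
  have hopen : IsOpen {v | y < b v} := isOpen_lt continuous_const hb
  rw [eq_top_iff]
  calc ∞ = ∫⁻ _ in {v | y < b v} ∩ Iic 1, ∞ ∂lebesgueNNReal := by
        rw [setLIntegral_const,
          ENNReal.top_mul (lebesgueNNReal_inter_Iic_one_pos hopen hy hu).ne']
    _ ≤ ∫⁻ v in {v | y < b v} ∩ Iic 1, noiseTail H κ (y - b v) ∂lebesgueNNReal := by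
        refine setLIntegral_mono' (hopen.measurableSet.inter measurableSet_Iic) fun v hv => ?_
        rw [noiseTail_of_nonpos hH hκ (sub_nonpos.2 (le_of_lt hv.1))]
    _ ≤ _ := lintegral_mono_set inter_subset_right

theorem exceedanceMass_le (hH : 0 < H) {M : ℝ} (hM : ∀ u ≤ 1, b u ≤ M) :
    exceedanceMass H κ y b ≤ noiseTail H κ (y - M) * lebesgueNNReal (Iic 1) := by
  rw [← setLIntegral_const]
  refine setLIntegral_mono' measurableSet_Iic fun u hu => ?_
  exact antitone_noiseTail hH (sub_le_sub_left (hM u hu) _)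

theorem exists_max_Iic_one (hb : Continuous b) : ∃ u ≤ 1, ∀ v ≤ 1, b v ≤ b u := by
  obtain ⟨u, hu, hmax⟩ := (isCompact_Icc (a := (0 : ℝ≥0)) (b := 1)).exists_isMaxOn
    ⟨0, le_rfl, zero_le_one⟩ hb.continuousOn
  exact ⟨u, hu.2, fun v hv => hmax ⟨zero_le, hv⟩⟩

theorem exceedanceMass_lt_top (hH : 0 < H) (hκ : 0 < κ) (hb : Continuous b)
    (hy : ∀ u ≤ 1, b u < y) : exceedanceMass H κ y b < ∞ := by
  obtain ⟨u, hu, hmax⟩ := exists_max_Iic_one hb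
  exact (exceedanceMass_le hH hmax).trans_lt (ENNReal.mul_lt_top
    (noiseTail_lt_top hκ (sub_pos.2 (hy u hu))) lebesgueNNReal_Iic_one_lt_top)

theorem measurable_noiseTail_sub (hb : Continuous b) (y : ℝ) :
    Measurable fun u => noiseTail H κ (y - b u) :=
  (continuous_noiseTail.comp (continuous_const.sub hb)).measurable

theorem exceedanceMass_lt_exceedanceMass (hH : 0 < H) (hκ : 0 < κ) (hb : Continuous b) {x : ℝ}
    (hxy : x < y) (hy : ∀ u ≤ 1, b u < y) :
    exceedanceMass H κ y b < exceedanceMass H κ x b := by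
  refine setLIntegral_strict_mono measurableSet_Iic ?_ (measurable_noiseTail_sub hb x)
    (exceedanceMass_lt_top hH hκ hb hy).ne ?_
  · have := lebesgueNNReal_inter_Iic_one_pos isOpen_univ (mem_univ (0 : ℝ≥0)) zero_le_one
    rw [univ_inter] at this
    exact this.ne'
  · exact .of_forall fun u hu =>
      noiseTail_lt_noiseTail hH hκ (sub_lt_sub_right hxy _) (sub_pos.2 (hy u hu))

theorem continuousAt_exceedanceMass (hH : 0 < H) (hκ : 0 < κ) (hb : Continuous b)
    (hy : ∀ u ≤ 1, b u < y) : ContinuousAt (fun y => exceedanceMass H κ y b) y := by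
  obtain ⟨u, hu, hmax⟩ := exists_max_Iic_one hb
  have hlt := hy u hu
  refine tendsto_lintegral_filter_of_dominated_convergence
    -- For levels above the midpoint of `max b` and `y`, the distance to the path is at least half
    -- the gap, which gives a constant dominating function.
    (fun _ => noiseTail H κ ((b u + y) / 2 - b u))
    (.of_forall fun z => measurable_noiseTail_sub hb z) ?_ ?_ (.of_forall fun v => ?_)
  · filter_upwards [lt_mem_nhds (show (b u + y) / 2 < y by linarith)] with z hz
    filter_upwards [ae_restrict_mem measurableSet_Iic] with v hv
    refine antitone_noiseTail hH ?_
    have := hmax v hv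
    linarith
  · rw [setLIntegral_const]
    exact (ENNReal.mul_lt_top (noiseTail_lt_top hκ (by linarith))
      lebesgueNNReal_Iic_one_lt_top).ne
  · exact (continuous_noiseTail.comp (continuous_id.sub continuous_const)).tendsto y

theorem tendsto_exceedanceMass_atTop (hH : 0 < H) (hb : Continuous b) :
    Tendsto (fun y => exceedanceMass H κ y b) atTop (𝓝 0) := by
  obtain ⟨u, hu, hmax⟩ := exists_max_Iic_one hb
  refine tendsto_of_tendsto_of_tendsto_of_le_of_le tendsto_const_nhds ?_ (fun _ => zero_le)
    fun y => exceedanceMass_le hH hmax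
  have h1 : Tendsto (fun y => noiseTail H κ (y - b u)) atTop (𝓝 0) :=
    (tendsto_noiseTail_atTop hH).comp (tendsto_atTop_add_const_right _ _ tendsto_id)
  simpa using ENNReal.Tendsto.mul_const h1 (.inr lebesgueNNReal_Iic_one_lt_top.ne)

end ExceedanceMass

/-! ### Infinite exceedance mass at level zero -/

section ProcessExceedance

variable {Ω : Type*} [MeasurableSpace Ω] {P : Measure Ω} {H κ : ℝ} {B : ℝ≥0 → Ω → ℝ}

theorem measurable_uncurry_noiseTail_sub (hBm : ∀ t, Measurable (B t))
    (hBc : ∀ ω, Continuous fun t => B t ω) (y : ℝ) :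
    Measurable fun p : Ω × ℝ≥0 => noiseTail H κ (y - B p.2 p.1) :=
  continuous_noiseTail.measurable.comp (measurable_const.sub
    ((measurable_uncurry_of_continuous_of_measurable hBc hBm).comp measurable_swap))

theorem measurable_exceedanceMass (hBm : ∀ t, Measurable (B t))
    (hBc : ∀ ω, Continuous fun t => B t ω) (y : ℝ) :
    Measurable fun ω => exceedanceMass H κ y (B · ω) :=
  (measurable_uncurry_noiseTail_sub hBm hBc y).lintegral_prod_right'

theorem lebesgueNNReal_singleton_zero : lebesgueNNReal {0} = 0 := by
  rw [lebesgueNNReal_apply (measurableSet_singleton 0)]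
  refine measure_mono_null (t := {(0 : ℝ)}) ?_ (by simp)
  rintro t ⟨h1, h2⟩
  exact le_antisymm (Real.toNNReal_eq_zero.1 h1) h2

/-- Chebyshev's inequality with variance `u ^ (2 * H)`: by scaling, the lost probability does not
depend on `u`. -/
theorem IsFractionalBrownianMotion.measure_le_real_inter_abs_lt [IsProbabilityMeasure P]
    (hB : IsFractionalBrownianMotion H B P) (hH : 0 < H) {E : Set Ω} {M : ℝ}
    (hM : 0 < M) {u : ℝ≥0} (hu : 0 < u) :
    P.real E - 1 / M ^ 2 ≤ P.real (E ∩ {ω | |B u ω| < M * (u : ℝ) ^ H}) := by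
  have hu' : (0 : ℝ) < u := hu
  have huH : 0 < (u : ℝ) ^ H := Real.rpow_pos_of_pos hu' H
  have hc : 0 < M * (u : ℝ) ^ H := by positivity
  have hcheb := meas_ge_le_variance_div_sq (hB.memLp_two u) hc
  rw [hB.mean_zero, hB.variance_eq hH] at hcheb
  have hsq : (u : ℝ) ^ (2 * H) = ((u : ℝ) ^ H) ^ 2 := by
    rw [mul_comm, Real.rpow_mul hu'.le, ← Real.rpow_two]
  have hval : (u : ℝ) ^ (2 * H) / (M * (u : ℝ) ^ H) ^ 2 = 1 / M ^ 2 := by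
    rw [hsq]
    field_simp
  rw [hval] at hcheb
  have hreal : P.real {ω | M * (u : ℝ) ^ H ≤ |B u ω - 0|} ≤ 1 / M ^ 2 :=
    ENNReal.toReal_le_of_le_ofReal (by positivity) hcheb
  have hsub : E ⊆ (E ∩ {ω | |B u ω| < M * (u : ℝ) ^ H}) ∪
      {ω | M * (u : ℝ) ^ H ≤ |B u ω - 0|} := by
    intro ω hω
    rcases lt_or_ge |B u ω| (M * (u : ℝ) ^ H) with h | h
    · exact .inl ⟨hω, h⟩
    · exact .inr (by simpa using h)
  have h1 := (measureReal_mono (μ := P) hsub).trans (measureReal_union_le _ _)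
  linarith

/-- The mean number of noise points that lift fractional Brownian motion above `0` before time `1`
is almost surely infinite. -/
theorem IsFractionalBrownianMotion.ae_exceedanceMass_zero_eq_top [IsProbabilityMeasure P]
    (hB : IsFractionalBrownianMotion H B P) (hH : 0 < H) (hκ : 0 < κ)
    (hBc : ∀ ω, Continuous fun t => B t ω) :
    ∀ᵐ ω ∂P, exceedanceMass H κ 0 (B · ω) = ∞ := by
  by_contra hnot
  -- If the mass is not almost surely infinite, it is bounded on an event of positive probability;
  -- its integral over that event will nevertheless be infinite.
  obtain ⟨C, hC⟩ : ∃ C : ℕ, P {ω | exceedanceMass H κ 0 (B · ω) ≤ C} ≠ 0 := by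
    by_contra! hall
    refine hnot ?_
    rw [ae_iff]
    refine measure_mono_null (fun ω hω => ?_) (measure_iUnion_null hall)
    obtain ⟨n, hn⟩ := ENNReal.exists_nat_gt hω
    exact mem_iUnion.2 ⟨n, hn.le⟩
  set E : Set Ω := {ω | exceedanceMass H κ 0 (B · ω) ≤ C} with hE
  have hEm : MeasurableSet E :=
    measurableSet_le (measurable_exceedanceMass hB.measurable hBc 0) measurable_const
  have hp : 0 < P.real E := ENNReal.toReal_pos hC (measure_ne_top _ _)
  set p := P.real E
  have hfin : ∫⁻ ω in E, exceedanceMass H κ 0 (B · ω) ∂P < ∞ :=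
    calc _ ≤ ∫⁻ _ in E, (C : ℝ≥0∞) ∂P := setLIntegral_mono' hEm fun ω hω => hω
      _ < ∞ := by
        rw [setLIntegral_const]
        exact ENNReal.mul_lt_top (ENNReal.natCast_lt_top C) (measure_lt_top _ _)
  -- With this `M`, Chebyshev's inequality loses exactly half of the probability `p` of `E`.
  set M : ℝ := √(2 / p)
  have hM : 0 < M := Real.sqrt_pos.2 (by positivity)
  have hM2 : 1 / M ^ 2 = p / 2 := by
    rw [Real.sq_sqrt (by positivity)]
    field_simp
  have hswap : ∫⁻ ω in E, exceedanceMass H κ 0 (B · ω) ∂P =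
      ∫⁻ u in Iic 1, ∫⁻ ω in E, noiseTail H κ (0 - B u ω) ∂P ∂lebesgueNNReal :=
    lintegral_lintegral_swap (measurable_uncurry_noiseTail_sub hB.measurable hBc 0).aemeasurable
  -- Where `|B u| < M * u ^ H`, the integrand is at least `κ * (M * u ^ H) ^ (-1/H) = κ * M ^ (-1/H)
  -- / u`.
  have hlower : ∀ u : ℝ≥0, 0 < u →
      ENNReal.ofReal (κ * M ^ (-(1 / H)) * (p / 2)) * (u : ℝ≥0∞)⁻¹ ≤
        ∫⁻ ω in E, noiseTail H κ (0 - B u ω) ∂P := by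
    intro u hu
    have hu' : (0 : ℝ) < u := hu
    have huH : 0 < (u : ℝ) ^ H := Real.rpow_pos_of_pos hu' H
    have hF : MeasurableSet (E ∩ {ω | |B u ω| < M * (u : ℝ) ^ H}) :=
      hEm.inter (measurableSet_lt (hB.measurable u).abs measurable_const)
    have hprob : ENNReal.ofReal (p / 2) ≤ P (E ∩ {ω | |B u ω| < M * (u : ℝ) ^ H}) := by
      have := hB.measure_le_real_inter_abs_lt hH (E := E) hM hu
      rw [hM2] at this
      rw [ENNReal.ofReal_le_iff_le_toReal (measure_ne_top _ _)]
      exact le_trans (by linarith) this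
    calc ENNReal.ofReal (κ * M ^ (-(1 / H)) * (p / 2)) * (u : ℝ≥0∞)⁻¹
        = noiseTail H κ (M * (u : ℝ) ^ H) * ENNReal.ofReal (p / 2) := by
          rw [noiseTail_of_pos hκ (by positivity), ← ENNReal.ofReal_coe_nnreal,
            ← ENNReal.ofReal_inv_of_pos hu', ← ENNReal.ofReal_mul (by positivity),
            ← ENNReal.ofReal_mul (by positivity)]
          congr 1
          rw [Real.mul_rpow hM.le huH.le, ← Real.rpow_mul hu'.le]
          have : H * -(1 / H) = -1 := by field_simp
          rw [this, Real.rpow_neg_one]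
          ring
      _ ≤ noiseTail H κ (M * (u : ℝ) ^ H) * P (E ∩ {ω | |B u ω| < M * (u : ℝ) ^ H}) := by
          gcongr
      _ = ∫⁻ _ in E ∩ {ω | |B u ω| < M * (u : ℝ) ^ H}, noiseTail H κ (M * (u : ℝ) ^ H) ∂P := by
          rw [setLIntegral_const]
      _ ≤ ∫⁻ ω in E ∩ {ω | |B u ω| < M * (u : ℝ) ^ H}, noiseTail H κ (0 - B u ω) ∂P := by
          refine setLIntegral_mono' hF fun ω hω => antitone_noiseTail hH ?_
          have h1 : |B u ω| < M * (u : ℝ) ^ H := hω.2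
          linarith [(abs_lt.1 h1).1]
      _ ≤ _ := lintegral_mono_set inter_subset_left
  have hae : ∀ᵐ u ∂(lebesgueNNReal.restrict (Iic 1)), 0 < u := by
    refine ae_restrict_of_ae ?_
    filter_upwards [measure_eq_zero_iff_ae_notMem.1 lebesgueNNReal_singleton_zero] with u hu
    exact pos_iff_ne_zero.2 hu
  have htop : ∞ ≤ ∫⁻ u in Iic 1, ∫⁻ ω in E, noiseTail H κ (0 - B u ω) ∂P ∂lebesgueNNReal :=
    calc ∞ = ∫⁻ u in Iic 1, ENNReal.ofReal (κ * M ^ (-(1 / H)) * (p / 2)) * (u : ℝ≥0∞)⁻¹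
          ∂lebesgueNNReal := by
          rw [lintegral_const_mul _ (by fun_prop), setLIntegral_inv_lebesgueNNReal,
            ENNReal.mul_top]
          have : 0 < κ * M ^ (-(1 / H)) * (p / 2) := by positivity
          simpa using this
      _ ≤ _ := lintegral_mono_ae (hae.mono hlower)
  rw [← hswap] at htop
  exact absurd hfin (not_lt.2 htop)

end ProcessExceedance

/-! ### Passing to a version with all paths continuous -/

section Reduction

variable {Ω : Type*} [MeasurableSpace Ω] {P : Measure Ω} {H κ : ℝ} {B B' : ℝ≥0 → Ω → ℝ}

theorem IsFractionalBrownianMotion.congr (hB : IsFractionalBrownianMotion H B P)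
    (hm : ∀ t, Measurable (B' t)) (h : ∀ᵐ ω ∂P, ∀ t, B t ω = B' t ω) :
    IsFractionalBrownianMotion H B' P := by
  have ht : ∀ t, B t =ᵐ[P] B' t := fun t => h.mono fun ω hω => hω t
  have hmean : ∀ t, ∫ ω, B' t ω ∂P = 0 := fun t => by
    rw [← hB.mean_zero t]
    exact integral_congr_ae (ht t).symm
  refine ⟨hm, hB.isGaussianProcess.congr ht, hmean, fun s t => ?_, ?_⟩
  · rw [← hB.covariance_eq s t]
    unfold covariance
    rw [hmean, hmean, hB.mean_zero, hB.mean_zero]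
    refine integral_congr_ae ?_
    filter_upwards [h] with ω hω
    rw [hω, hω]
  · filter_upwards [h, hB.continuous_paths] with ω hω hc
    simpa only [hω] using hc

theorem IsFractionalBrownianMotion.exists_continuous (hB : IsFractionalBrownianMotion H B P) :
    ∃ B' : ℝ≥0 → Ω → ℝ, (∀ t, Measurable (B' t)) ∧ (∀ ω, Continuous fun t => B' t ω) ∧
      ∀ᵐ ω ∂P, ∀ t, B t ω = B' t ω := by
  classical
  obtain ⟨N, hN, hNm, hN0⟩ := exists_measurable_superset_of_null (ae_iff.1 hB.continuous_paths)
  refine ⟨fun t => N.piecewise 0 (B t), fun t => measurable_zero.piecewise hNm (hB.measurable t),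
    fun ω => ?_, ?_⟩
  · by_cases hω : ω ∈ N
    · simpa [hω] using continuous_const
    · have : Continuous fun t => B t ω := by
        by_contra hc
        exact hω (hN hc)
      simpa [hω] using this
  · filter_upwards [measure_eq_zero_iff_ae_notMem.1 hN0] with ω hω t
    simp [hω]

end Reduction

/-! ### The properties of the distribution function -/

theorem proposition2 {Ω : Type*} [MeasurableSpace Ω] (P : Measure Ω) [IsProbabilityMeasure P]
    (H κ : ℝ) (hH : H ∈ Set.Ioo (0 : ℝ) 1) (hκ : 0 < κ)
    (B : ℝ≥0 → Ω → ℝ) (hB : IsFractionalBrownianMotion H B P)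
    (X : ℕ → Ω → ℝ≥0 × ℝ≥0) (hX : IsPoissonPointProcess X (shotNoiseIntensity H) P)
    (hBX : IndepOfPointProcess B X P) :
    (∀ x : ℝ, x ≤ 0 → marginalCDF H κ B X P x = 0) ∧
      ContinuousOn (marginalCDF H κ B X P) (Set.Ioi 0) ∧
      StrictMonoOn (marginalCDF H κ B X P) (Set.Ioi 0) ∧
      Tendsto (marginalCDF H κ B X P) atTop (𝓝 1) := by
  have hH0 := hH.1
  obtain ⟨B', hm', hc', hBB'⟩ := hB.exists_continuous
  have hB' := hB.congr hm' hBB'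
  have hBX' : IndepOfPointProcess B' X P :=
    hBX.congr (hBB'.mono fun ω hω => funext hω) (ae_eq_refl _)
  have hcdf : marginalCDF H κ B X P = fun y =>
      (∫⁻ ω, EReal.exp (-(exceedanceMass H κ y (B' · ω) : EReal)) ∂P).toReal := by
    funext y
    rw [← marginalCDF_eq hH0 hκ hm' hc' hX hBX', marginalCDF, marginalCDF]
    refine measureReal_congr ?_
    filter_upwards [hBB'] with ω hω
    refine propext ?_
    change maxProcess H κ B X 1 ω ≤ y ↔ maxProcess H κ B' X 1 ω ≤ y
    simp only [maxProcess, hω]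
  rw [hcdf]
  have hmeas : ∀ y, Measurable fun ω =>
      EReal.exp (-(exceedanceMass H κ y (B' · ω) : EReal)) := fun y =>
    continuous_exp_neg_coe_ennreal.measurable.comp (measurable_exceedanceMass hm' hc' y)
  have hle : ∀ y, ∫⁻ ω, EReal.exp (-(exceedanceMass H κ y (B' · ω) : EReal)) ∂P ≤ 1 := fun y =>
    (lintegral_mono fun ω => exp_neg_coe_ennreal_le_one _).trans (by simp)
  have hfin : ∀ y, ∫⁻ ω, EReal.exp (-(exceedanceMass H κ y (B' · ω) : EReal)) ∂P ≠ ∞ := fun y =>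
    ((hle y).trans_lt ENNReal.one_lt_top).ne
  have hlim : ∀ (l : Filter ℝ) [l.IsCountablyGenerated] (f : Ω → ℝ≥0∞),
      (∀ᵐ ω ∂P, Tendsto (fun y => EReal.exp (-(exceedanceMass H κ y (B' · ω) : EReal))) l
        (𝓝 (f ω))) →
      Tendsto (fun y => ∫⁻ ω, EReal.exp (-(exceedanceMass H κ y (B' · ω) : EReal)) ∂P) l
        (𝓝 (∫⁻ ω, f ω ∂P)) := fun l _ f hf =>
    tendsto_lintegral_filter_of_dominated_convergence (fun _ => 1) (.of_forall hmeas)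
      (.of_forall fun y => .of_forall fun ω => exp_neg_coe_ennreal_le_one _) (by simp) hf
  refine ⟨fun x hx => ?_, fun y hy => ?_, fun x hx y hy hxy => ?_, ?_⟩
  · beta_reduce
    rw [lintegral_eq_zero_of_ae_eq_zero, ENNReal.toReal_zero]
    filter_upwards [hB'.ae_exceedanceMass_zero_eq_top hH0 hκ hc'] with ω hω
    have : exceedanceMass H κ x (B' · ω) = ∞ :=
      eq_top_iff.2 (hω.ge.trans (antitone_exceedanceMass hH0 _ hx))
    rw [this, exp_neg_coe_ennreal_top]
    rfl
  · refine ContinuousAt.continuousWithinAt ?_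
    refine (ENNReal.tendsto_toReal (hfin y)).comp (hlim (𝓝 y) _ ?_)
    filter_upwards [hB'.ae_not_max_eq hH0 hc' hy] with ω hω
    refine (continuous_exp_neg_coe_ennreal.tendsto _).comp ?_
    -- Either the maximum is strictly below `y`, as equality has been excluded, or it exceeds `y`
    -- and the mass is infinite at all nearby levels.
    by_cases hle : ∀ u ≤ 1, B' u ω ≤ y
    · exact continuousAt_exceedanceMass hH0 hκ (hc' ω) (hω hle)
    · push Not at hle
      obtain ⟨u, hu, hlt⟩ := hle
      refine tendsto_nhds_of_eventually_eq ?_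
      filter_upwards [gt_mem_nhds hlt] with z hz
      rw [exceedanceMass_eq_top hH0 hκ (hc' ω) hu hz, exceedanceMass_eq_top hH0 hκ (hc' ω) hu hlt]
  · refine (ENNReal.toReal_lt_toReal (hfin x) (hfin y)).2 ?_
    -- The strict inequality is needed only on the event that the path stays below `x`, which has
    -- positive probability.
    refine lintegral_strict_mono_of_ae_le_of_ae_lt_on (hmeas y).aemeasurable (hfin x)
      (.of_forall fun ω => strictAnti_exp_neg_coe_ennreal.antitone
        (antitone_exceedanceMass hH0 _ hxy.le))
      (hB'.measure_forall_le_pos hH0 hc' hx).ne' (.of_forall fun ω hω => ?_)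
    exact strictAnti_exp_neg_coe_ennreal (exceedanceMass_lt_exceedanceMass hH0 hκ (hc' ω) hxy
      fun u hu => (hω u hu).trans_lt hxy)
  · have h1 := hlim atTop (fun _ => 1) (.of_forall fun ω => by
      have := (continuous_exp_neg_coe_ennreal.tendsto 0).comp
        (tendsto_exceedanceMass_atTop (H := H) (κ := κ) hH0 (hc' ω))
      simpa [Function.comp_def] using this)
    have h2 := (ENNReal.tendsto_toReal (by simp)).comp h1
    simpa [Function.comp_def] using h2
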